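/- Let $\Sigma$ be a finite non-empty alphabet. A game automaton is a tuple $\mathcal A=\langle\Sigma,Q,q_0,\delta,\pi\rangle$ with $Q$ a finite set of states, $q_0\in Q$, $\pi:Q\to\mathbb N$, and such that each transition $\delta(q,a)$, for $q\in Q$ and $a\in\Sigma$, is of the form $(L,q_L)\vee(R,q_R)$ or $(L,q_L)\wedge(R,q_R)$. It accepts a $\Sigma$-tree $t:\{L,R\}^*\to\Sigma$ if Player $\exists$ has a winning strategy in the game that starts at $\langle\epsilon,q_0\rangle$ and in which, at $\langle x,q\rangle$, Player $\exists$ (if $\delta(q,t(x))=(L,q_L)\vee(R,q_R)$) or Player $\forall$ (if $\delta(q,t(x))=(L,q_L)\wedge(R,q_R)$) moves to $\langle xL,q_L\rangle$ or $\langle xR,q_R\rangle$; a play is won by $\exists$ if the maximal priority $\pi(q)$ of the states $q$ that occur infinitely often is even. Let $L(\mathcal A)$ be the set of accepted trees, and let $\mu$ be the coin-flipping measure on $\Sigma^{\{L,R\}^*}$, under which the labels of the vertices are independent and uniform on $\Sigma$. A Markov branching play (MBP) $\mathcal M$ consists of a finite directed graph $(S,E)$ in which each vertex has a successor, a partition of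 $S$ into probabilistic, $\exists$-branching and $\forall$-branching states, a probability distribution $p(s)$ on the successors of $s$ for each probabilistic state $s$, and a priority function $Par:S\to\mathbb N$. It generates from $s\in S$ a random tree labelled by states (a branching play): the root is labelled $s$; independently of all other vertices, a vertex labelled by a probabilistic state $s'$ gets one child, whose label is drawn from $p(s')$, and a vertex labelled by a branching state gets one child for each successor of that state. The value $val(\mathcal M,s)$ is the probability, under the law $\mu_{\mathcal M}$ of this random tree, of the set $\mathcal W_s$ of the branching plays $T$ such that $\exists$ has a winning strategy in the parity game played on $T$ from its root, where $\exists$ (resp. $\forall$) moves at the vertices labelled by $\exists$-branching (resp. $\forall$-branching) states, the game progresses automatically at the other vertices, and $\exists$ wins if the maximal priority that occurs infinitely often is even. The MBP $\mathcal M_{\mathcal A}$ associated with $\mathcal A$ has a probabilistic state $s_q$ for each $q\in Q$ and a state $s_{q,a}$ for each $(q,a)\in Q\times\Sigma$, which is $\exists$-branching if $\delta(q,a)=(L,q_L)\vee(R,q_R)$ and $\forall$-branching if $\delta(q,a)=(L,q_L)\wedge(R,q_R)$. The successors of $s_q$ are the states $s_{q,a}$, $a\in\Sigma$, with $p(s_q)(s_{q,a})=1/|\Sigma|$;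 the successors of $s_{q,a}$ are $s_{q_L}$ and $s_{q_R}$; and $Par(s_q)=Par(s_{q,a})=\pi(q)$. **Theorem (Correctness of Reduction).** Let $\mathcal A$ be a game automaton. (1) If $q_L\neq q_R$ in each transition of $\mathcal A$, then $\mu(L(\mathcal A))=val(\mathcal M_{\mathcal A},s_{q_0})$. Moreover, there is a bijection $\Phi$, measurable in both directions and measure preserving, from the $\Sigma$-trees with $\mu$ to the branching plays of $\mathcal M_{\mathcal A}$ from $s_{q_0}$ with $\mu_{\mathcal M_{\mathcal A}}$, such that $t\in L(\mathcal A)$ if and only if $\Phi(t)\in\mathcal W_{s_{q_0}}$. (2) In general, let $\mathcal A'$ be the game automaton obtained from $\mathcal A$ by duplicating its states: its states are $(q,d)\in Q\times\{L,R\}$ with priority $\pi(q)$, its initial state is $(q_0,L)$, and its transition at $(q,d)$ and $a$ is $\delta(q,a)$ with $(L,q_L)$, $(R,q_R)$ replaced by $(L,(q_L,L))$, $(R,(q_R,R))$. Then $\mathcal A'$ satisfies the hypothesis of (1), $L(\mathcal A')=L(\mathcal A)$, and $\mu(L(\mathcal A))=val(\mathcal M_{\mathcal A'},s_{(q_0,L)})$.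 -/

import Mathlib

noncomputable section

namespace GameAut

/-! ### Two-player games of infinite duration -/

/-- A two-player game of infinite duration between `∃` and `∀` on the set of positions `V`.
The positions which do not belong to `∃` belong to `∀`; positions from which the game progresses
automatically have a unique move, so it is irrelevant to whom they are assigned.
All games below have at least one move from every position. -/
structure Game (V : Type*) where
  init : V
  existsTurn : V → Prop
  move : V → V → Prop
  /-- the infinite plays which are won by `∃` -/
  win : (ℕ → V) → Prop

namespace Game

variable {V : Type*} (G : Game V)

/-- A strategy for `∃` maps every finite play `w ++ [v]` ending in a position `v` of `∃` to a legal
move from `v`. -/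
def IsStrategy (σ : List V → V) : Prop :=
  ∀ (w : List V) (v : V), G.existsTurn v → G.move v (σ (w ++ [v]))

/-- `ρ` is an infinite play of the game in which `∃` follows `σ`. -/
structure IsPlay (σ : List V → V) (ρ : ℕ → V) : Prop where
  init : ρ 0 = G.init
  move : ∀ n, G.move (ρ n) (ρ (n + 1))
  follows : ∀ n, G.existsTurn (ρ n) → ρ (n + 1) = σ ((List.range (n + 1)).map ρ)

/-- Player `∃` has a winning strategy. -/
def ExistsWins : Prop :=
  ∃ σ : List V → V, G.IsStrategy σ ∧ ∀ ρ, G.IsPlay σ ρ → G.win ρ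

end Game

/-- The set `P` of priorities has a maximum, and this maximum is even. -/
def MaxEven (P : Set ℕ) : Prop := ∃ m, IsGreatest P m ∧ Even m

/-! ### Trees and the coin-flipping measure -/

/-- The two directions `L` and `R`. -/
inductive Dir where
  | L
  | R

/-- A `Λ`-tree: a labelling of the vertices `{L,R}^*` of the full binary tree by letters. -/
def LabelledTree (Λ : Type*) : Type _ := List Dir → Λ

/-- The product σ-algebra, where the alphabet is discrete. -/
instance (Λ : Type*) : MeasurableSpace (LabelledTree Λ) :=
  @MeasurableSpace.pi (List Dir) (fun _ => Λ) (fun _ => ⊤)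

/-- The coin-flipping measure: the labels of the vertices are independent and uniform. -/
def coinFlipping (Λ : Type*) [Fintype Λ] [Nonempty Λ] :
    MeasureTheory.Measure (LabelledTree Λ) :=
  letI : MeasurableSpace Λ := ⊤
  MeasureTheory.Measure.infinitePi
    (fun _ : List Dir => (PMF.uniformOfFintype Λ).toMeasure)

/-! ### Alternating parity tree automata -/

/-- The expressions `e ::= x ∈ X | e ∧ e | e ∨ e`. -/
inductive DL (X : Type*) where
  | atom : X → DL X
  | and : DL X → DL X → DL X
  | or : DL X → DL X → DL X

/-- Renaming of atoms. -/
def DL.map {X Y : Type*} (f : X → Y) : DL X → DL Y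
  | .atom x => .atom (f x)
  | .and e₁ e₂ => .and (e₁.map f) (e₂.map f)
  | .or e₁ e₂ => .or (e₁.map f) (e₂.map f)

/-- An alternating parity tree automaton over the alphabet `Λ` with set of states `Q`
(both are assumed to be finite where this is used). -/
structure Automaton (Λ Q : Type*) where
  q₀ : Q
  δ : Q → Λ → DL (Dir × Q)
  π : Q → ℕ

namespace Automaton

variable {Λ Q : Type*} (A : Automaton Λ Q)

/-- Positions `⟨x, q⟩` and `⟨x, e⟩` of the acceptance game. -/
abbrev Position (Q : Type*) : Type _ := List Dir × (Q ⊕ DL (Dir × Q))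

/-- The moves of the acceptance game on the tree `t`. -/
inductive Move (t : LabelledTree Λ) : Position Q → Position Q → Prop
  | read (x : List Dir) (q : Q) : Move t (x, .inl q) (x, .inr (A.δ q (t x)))
  | orLeft (x : List Dir) (e₁ e₂ : DL (Dir × Q)) : Move t (x, .inr (.or e₁ e₂)) (x, .inr e₁)
  | orRight (x : List Dir) (e₁ e₂ : DL (Dir × Q)) : Move t (x, .inr (.or e₁ e₂)) (x, .inr e₂)
  | andLeft (x : List Dir) (e₁ e₂ : DL (Dir × Q)) : Move t (x, .inr (.and e₁ e₂)) (x, .inr e₁)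
  | andRight (x : List Dir) (e₁ e₂ : DL (Dir × Q)) : Move t (x, .inr (.and e₁ e₂)) (x, .inr e₂)
  | step (x : List Dir) (d : Dir) (q : Q) : Move t (x, .inr (.atom (d, q))) (x ++ [d], .inl q)

/-- The automaton states which occur infinitely often in a play. -/
def infStates (ρ : ℕ → Position Q) : Set Q :=
  {q | ∃ᶠ n in Filter.atTop, ∃ x, ρ n = (x, .inl q)}

/-- The acceptance game of `A` on the tree `t`. -/
def acceptanceGame (t : LabelledTree Λ) : Game (Position Q) where
  init := ([], .inl A.q₀)
  existsTurn v := ∃ x e₁ e₂, v = (x, .inr (.or e₁ e₂))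
  move := A.Move t
  win ρ := MaxEven (A.π '' infStates ρ)

/-- The set of trees accepted by `A`. -/
def language : Set (LabelledTree Λ) := {t | (A.acceptanceGame t).ExistsWins}

/-- `δ(q,a)` is `(L,q₁) ∨ (R,q₂)` or `(L,q₁) ∧ (R,q₂)`. -/
def HasTargets (q : Q) (a : Λ) (q₁ q₂ : Q) : Prop :=
  A.δ q a = .or (.atom (.L, q₁)) (.atom (.R, q₂)) ∨
    A.δ q a = .and (.atom (.L, q₁)) (.atom (.R, q₂))

/-- `A` is a game automaton. -/
def IsGame : Prop := ∀ q a, ∃ q₁ q₂, A.HasTargets q a q₁ q₂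

/-- In each transition `(L,q₁) ∨ (R,q₂)` or `(L,q₁) ∧ (R,q₂)` of `A` the states `q₁`, `q₂` are
distinct. -/
def TargetsDistinct : Prop := ∀ q a q₁ q₂, A.HasTargets q a q₁ q₂ → q₁ ≠ q₂

/-- The automaton with two copies `(q,L)`, `(q,R)` of every state `q`, both behaving as `q`, where
direction `d` is always entered through a copy of the form `(q,d)`. -/
def duplicate : Automaton Λ (Q × Dir) where
  q₀ := (A.q₀, .L)
  δ q a := (A.δ q.1 a).map fun x => (x.1, (x.2, x.1))
  π q := A.π q.1

theorem IsGame.duplicate {A : Automaton Λ Q} (hA : A.IsGame) : A.duplicate.IsGame := by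
  intro q a
  obtain ⟨q₁, q₂, h | h⟩ := hA q.1 a
  · exact ⟨(q₁, .L), (q₂, .R), Or.inl (by simp [Automaton.duplicate, h, DL.map])⟩
  · exact ⟨(q₁, .L), (q₂, .R), Or.inr (by simp [Automaton.duplicate, h, DL.map])⟩

end Automaton

/-! ### Markov branching plays -/

/-- The three kinds of states of a Markov branching play. -/
inductive Kind where
  | prob
  | existsBranch
  | forallBranch

/-- A Markov branching play with set of states `S` (assumed to be finite where this is used).
The partition of `S` is given by the function `kind`; `p` gives for every probabilistic state `s` a
discrete probability distribution on the set of successors of `s`. -/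
structure MBP (S : Type*) where
  E : S → S → Prop
  exists_succ : ∀ s, ∃ s', E s s'
  kind : S → Kind
  p : ∀ s, kind s = .prob → PMF {s' // E s s'}
  par : S → ℕ

/-- A finite non-empty path of states, given as the pair of the list of its earlier states, the most
recent one first, and of its last state. -/
abbrev FinPath (S : Type*) : Type _ := List S × S

/-- The path extended by one more state. -/
def FinPath.extend {S : Type*} (x : FinPath S) (s : S) : FinPath S := (x.2 :: x.1, s)

namespace MBP

variable {S : Type*} (M : MBP S)

/-- `T` is (the set of vertices of) a branching play from `s₀`. Siblings have different labels, so a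
vertex is identified with the sequence of labels on the path from the root to it, and its label is
the last state of this path. Vertices labelled by a probabilistic state have a unique child, and
vertices labelled by a branching state have one child for each successor of that state. -/
structure IsBranchingPlay (s₀ : S) (T : Set (FinPath S)) : Prop where
  root : ∀ s, (([], s) : FinPath S) ∈ T ↔ s = s₀
  parent : ∀ (x : FinPath S) (s : S), x.extend s ∈ T → x ∈ T ∧ M.E x.2 s
  prob : ∀ x ∈ T, M.kind x.2 = .prob → ∃! s, x.extend s ∈ T
  branch : ∀ x ∈ T, M.kind x.2 ≠ .prob → ∀ s, M.E x.2 s → x.extend s ∈ T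

/-- The space of branching plays from `s₀`. -/
def BranchingPlay (s₀ : S) : Type _ := {T : Set (FinPath S) // M.IsBranchingPlay s₀ T}

/-- The σ-algebra generated by the sets `{T | x ∈ T}`, for `x` a finite path. -/
instance (s₀ : S) : MeasurableSpace (M.BranchingPlay s₀) :=
  inferInstanceAs (MeasurableSpace {T : Set (FinPath S) // M.IsBranchingPlay s₀ T})

/-- The potential vertices labelled by a probabilistic state. -/
abbrev ProbVertex : Type _ := {x : FinPath S // M.kind x.2 = .prob}

/-- A choice of a successor at every potential vertex labelled by a probabilistic state. -/
def Choice : Type _ := ∀ x : M.ProbVertex, {s // M.E x.1.2 s}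

instance : MeasurableSpace M.Choice :=
  @MeasurableSpace.pi M.ProbVertex (fun x => {s // M.E x.1.2 s}) (fun _ => ⊤)

/-- The choices at all vertices are independent, and the successor of a vertex labelled by `s` is
chosen according to `p s`. -/
def choiceMeasure : MeasureTheory.Measure M.Choice :=
  letI : ∀ x : M.ProbVertex, MeasurableSpace {s // M.E x.1.2 s} := fun _ => ⊤
  MeasureTheory.Measure.infinitePi (fun x : M.ProbVertex => (M.p x.1.2 x.2).toMeasure)

open Classical in
/-- The path with earlier states `h` and last state `s` belongs to the tree grown from the root `s₀`
with the choices `c`. -/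
def Generated (s₀ : S) (c : M.Choice) : List S → S → Prop
  | [], s => s = s₀
  | r :: h, s => Generated s₀ c h r ∧
      if hr : M.kind r = .prob then (c ⟨(h, r), hr⟩ : S) = s else M.E r s

theorem isBranchingPlay_generated (s₀ : S) (c : M.Choice) :
    M.IsBranchingPlay s₀ {x | M.Generated s₀ c x.1 x.2} where
  root s := Iff.rfl
  parent x s hx := by
    obtain ⟨h1, h2⟩ := hx
    refine ⟨h1, ?_⟩
    by_cases hr : M.kind x.2 = .prob
    · rw [dif_pos hr] at h2
      change _ = s at h2
      rw [← h2]
      exact (c ⟨(x.1, x.2), hr⟩).2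
    · rwa [dif_neg hr] at h2
  prob x hx hr := by
    refine ⟨c ⟨(x.1, x.2), hr⟩, ⟨hx, ?_⟩, ?_⟩
    · rw [dif_pos hr]
      rfl
    · rintro s ⟨_, h2⟩
      rw [dif_pos hr] at h2
      exact h2.symm
  branch x hx hr s hs := by
    refine ⟨hx, ?_⟩
    rwa [dif_neg hr]

/-- The branching play grown from the root `s₀` with the choices `c`. -/
def generate (s₀ : S) (c : M.Choice) : M.BranchingPlay s₀ :=
  ⟨{x | M.Generated s₀ c x.1 x.2}, M.isBranchingPlay_generated s₀ c⟩

theorem measurable_generate (s₀ : S) : Measurable (M.generate s₀) := by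
  refine Measurable.subtype_mk ?_
  refine measurable_set_iff.2 ?_
  rintro ⟨h, s⟩
  change Measurable fun c => M.Generated s₀ c h s
  induction h generalizing s with
  | nil => exact measurable_const
  | cons r h ih =>
    refine (ih r).and ?_
    by_cases hr : M.kind r = .prob
    · simp only [dif_pos hr]
      let _ : ∀ r : S, MeasurableSpace {s // M.E r s} := fun _ => ⊤
      have h1 : Measurable fun c : M.Choice => c ⟨(h, r), hr⟩ :=
        measurable_pi_apply (X := fun x : M.ProbVertex => {s // M.E x.1.2 s}) ⟨(h, r), hr⟩
      have h2 : Measurable fun u : {s' // M.E r s'} => (u : S) = s := measurable_from_top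
      exact h2.comp h1
    · simp only [dif_neg hr]
      exact measurable_const

/-- The law of the random branching play from `s₀`. -/
def playMeasure (s₀ : S) : MeasureTheory.Measure (M.BranchingPlay s₀) :=
  M.choiceMeasure.map (M.generate s₀)

/-- The parity game played on the branching play `T`, from its root. -/
def playGame {s₀ : S} (T : M.BranchingPlay s₀) : Game {x // x ∈ T.1} where
  init := ⟨([], s₀), (T.2.root s₀).2 rfl⟩
  existsTurn x := M.kind x.1.2 = .existsBranch
  move x y := ∃ s, y.1 = x.1.extend s
  win ρ := MaxEven {k | ∃ᶠ n in Filter.atTop, M.par (ρ n).1.2 = k}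

/-- The branching plays from `s₀` which are winning for `∃`. -/
def winning (s₀ : S) : Set (M.BranchingPlay s₀) := {T | (M.playGame T).ExistsWins}

/-- The value of `M` at `s₀`. -/
def val (s₀ : S) : ENNReal := M.playMeasure s₀ (M.winning s₀)

end MBP

/-! ### From game automata to Markov branching plays -/

namespace Automaton

variable {Λ Q : Type*} (A : Automaton Λ Q)

/-- The kind of the state `s_q` (`Sum.inl q`) or `s_{q,a}` (`Sum.inr (q, a)`). -/
def stateKind : Q ⊕ Q × Λ → Kind
  | .inl _ => .prob
  | .inr (q, a) =>
    match A.δ q a with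
    | .or _ _ => .existsBranch
    | _ => .forallBranch

/-- The edges from `s_q` to `s_{q,a}`, and from `s_{q,a}` to `s_{q₁}` and `s_{q₂}`. -/
inductive Edge : Q ⊕ Q × Λ → Q ⊕ Q × Λ → Prop
  | letter (q : Q) (a : Λ) : Edge (.inl q) (.inr (q, a))
  | left (q : Q) (a : Λ) (q₁ q₂ : Q) (h : A.HasTargets q a q₁ q₂) :
      Edge (.inr (q, a)) (.inl q₁)
  | right (q : Q) (a : Λ) (q₁ q₂ : Q) (h : A.HasTargets q a q₁ q₂) :
      Edge (.inr (q, a)) (.inl q₂)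

/-- The distribution `p(s_q)(s_{q,a}) = 1 / |Λ|` on the successors of `s_q`. -/
def stateProb [Fintype Λ] [Nonempty Λ] :
    ∀ s, A.stateKind s = .prob → PMF {s' // A.Edge s s'}
  | .inl q, _ => (PMF.uniformOfFintype Λ).map fun a => ⟨.inr (q, a), .letter q a⟩
  | .inr (q, a), h => absurd h (by cases hd : A.δ q a <;> simp [stateKind, hd])

/-- The priority `π(q)` of the states `s_q` and `s_{q,a}`. -/
def statePar : Q ⊕ Q × Λ → ℕ
  | .inl q => A.π q
  | .inr (q, _) => A.π q

/-- The Markov branching play associated with a game automaton. -/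
def toMBP [Fintype Λ] [Nonempty Λ] (hA : A.IsGame) : MBP (Q ⊕ Q × Λ) where
  E := A.Edge
  exists_succ
    | .inl q => ⟨_, .letter q (Classical.arbitrary Λ)⟩
    | .inr (q, a) => by
      obtain ⟨q₁, q₂, h⟩ := hA q a
      exact ⟨_, .left q a q₁ q₂ h⟩
  kind := A.stateKind
  p := A.stateProb
  par := A.statePar

end Automaton

end GameAut

end

open GameAut

/-!
Both the acceptance game on a tree `t` and the parity game on a branching play consist of rounds in
which exactly one direction is chosen, all other moves being forced. Such a game is equivalent to a
game on the full binary tree, in which the players build a branch direction by direction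
(`Game.Unfolding.existsWins_iff`): a position together with the time at which it is reached
determines the directions chosen before, so that strategies can be translated in both ways. For the
acceptance game this needs nothing but the form of the transitions
(`Automaton.IsGame.mem_language_iff`), and since the resulting game on the binary tree depends on the
states visited only through their transitions and priorities, duplicating the states does not change
the language.

If the two targets of every transition are distinct, the directions leading to a vertex of a
branching play can be read off its sequence of labels (`Automaton.IsGame.directions`). Hence a tree
`t` determines choices at all vertices labelled by a state `s_q` (`choiceOf`), and the branching play
grown with these choices has exactly the vertices which correspond to vertices of `t`. Conversely,
the letters chosen along a branching play form a tree (`treeOf`), and this gives the measurable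
bijection `playEquiv`. It identifies the two games, by `playOf_mem_winning_iff`.

The bijection preserves the measure because `treeOf` maps the law of the choices to the
coin-flipping measure (`map_treeOf`). The vertex at which a letter of the tree is chosen depends on
the letters chosen before. But on a finite set of vertices closed under prefixes, the event that the
letters are those of a fixed tree `t` is the event that the choices at the vertices given by `t` are
those given by `t`; these vertices are distinct and do not depend on the choices, so the event has
the probability of a cylinder of the product measure (`choiceMeasure_treeOf_eqOn`).
-/

noncomputable section

namespace GameAut

/-! ### Games whose plays are infinite sequences of directions -/

instance : Finite Dir :=
  Finite.of_surjective (fun b : Bool => if b then Dir.L else Dir.R)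
    fun d => by cases d; exacts [⟨true, rfl⟩, ⟨false, rfl⟩]

/-- The first `n` terms of the sequence `b`, the most recent one first. -/
def initialSegment (b : ℕ → Dir) : ℕ → List Dir
  | 0 => []
  | n + 1 => b n :: initialSegment b n

@[simp]
theorem length_initialSegment (b : ℕ → Dir) (n : ℕ) : (initialSegment b n).length = n := by
  induction n with
  | zero => rfl
  | succ n ih => simp [initialSegment, ih]

theorem drop_initialSegment (b : ℕ → Dir) {m n : ℕ} (h : m ≤ n) :
    (initialSegment b n).drop (n - m) = initialSegment b m := by
  induction n, h using Nat.le_induction with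
  | base => simp
  | succ n h ih => rw [Nat.succ_sub h]; simpa [initialSegment] using ih

/-- `∃` wins the game on the full binary tree in which a branch is built direction by direction,
`∃` chooses the next direction at the vertices satisfying `turn`, and the resulting branch has to
satisfy `win`. Vertices are given as lists of directions, the most recent one first. -/
def WinsOnBinaryTree (turn : List Dir → Prop) (win : (ℕ → Dir) → Prop) : Prop :=
  ∃ τ : List Dir → Dir, ∀ b : ℕ → Dir,
    (∀ n, turn (initialSegment b n) → b n = τ (initialSegment b n)) → win b

/-- An identification of the plays of `G` with the branches of the full binary tree. Before time `n`
exactly `count n` directions have been chosen, and `pos n r` is the position at time `n` if these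
directions are `r`, the most recent one first. The `m`-th direction is chosen at time `time m`; at
all other times the move is forced. Lists `r` whose length is not `count n` are irrelevant. -/
structure Game.Unfolding {V : Type*} (G : Game V) where
  pos : ℕ → List Dir → V
  count : ℕ → ℕ
  time : ℕ → ℕ
  count_zero : count 0 = 0
  count_succ : ∀ n, count (n + 1) = count n ∨ count (n + 1) = count n + 1
  count_time : ∀ m, count (time m) = m
  count_time_succ : ∀ m, count (time m + 1) = m + 1
  time_count : ∀ n, count (n + 1) = count n + 1 → n = time (count n)
  pos_zero : pos 0 [] = G.init
  pos_injective : ∀ n r r', r.length = count n → r'.length = count n → pos n r = pos n r' → r = r'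
  move_forced : ∀ n r, r.length = count n → count (n + 1) = count n →
    ∀ v, G.move (pos n r) v ↔ v = pos (n + 1) r
  move_choice : ∀ n r, r.length = count n → count (n + 1) = count n + 1 →
    ∀ v, G.move (pos n r) v ↔ ∃ d, v = pos (n + 1) (d :: r)
  exists_move : ∀ v, G.existsTurn v → ∃ v', G.move v v'

namespace Game.Unfolding

variable {V : Type*} {G : Game V} (U : G.Unfolding)

/-- The play of `G` in which the directions `b` are chosen. -/
def play (b : ℕ → Dir) (n : ℕ) : V := U.pos n (initialSegment b (U.count n))

theorem monotone_count : Monotone U.count :=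
  monotone_nat_of_le_succ fun n => by rcases U.count_succ n with h | h <;> omega

theorem move_play (b : ℕ → Dir) (n : ℕ) : G.move (U.play b n) (U.play b (n + 1)) := by
  unfold play
  rcases U.count_succ n with h | h
  · rw [U.move_forced n _ (by simp) h, h]
  · rw [U.move_choice n _ (by simp) h, h]
    exact ⟨_, rfl⟩

/-- The positions up to and including the one in which the successor of the vertex `r` is chosen. -/
def history (r : List Dir) : List V :=
  (List.range (U.time r.length + 1)).map fun i => U.pos i (r.drop (r.length - U.count i))

theorem history_initialSegment (b : ℕ → Dir) (m : ℕ) :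
    U.history (initialSegment b m) = (List.range (U.time m + 1)).map (U.play b) := by
  unfold history
  rw [length_initialSegment]
  refine List.map_congr_left fun i hi => ?_
  have h : U.count i ≤ m := by
    have := U.monotone_count (Nat.le_of_lt_succ (List.mem_range.1 hi))
    rwa [U.count_time] at this
  rw [drop_initialSegment b h, play]

theorem history_eq (r : List Dir) :
    ∃ w, U.history r = w ++ [U.pos (U.time r.length) r] := by
  refine ⟨(List.range (U.time r.length)).map fun i => U.pos i (r.drop (r.length - U.count i)), ?_⟩
  rw [history, List.range_succ, List.map_append]
  simp [U.count_time]

/-- `∃` has a strategy in `G` which plays the directions prescribed by `τ`. It is well defined since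
a position and the time at which it is reached determine the directions chosen so far. -/
theorem exists_strategy (τ : List Dir → Dir) : ∃ σ : List V → V, G.IsStrategy σ ∧
    ∀ (w : List V) (r : List Dir), r.length = U.count w.length →
      U.count (w.length + 1) = U.count w.length + 1 →
      σ (w ++ [U.pos w.length r]) = U.pos (w.length + 1) (τ r :: r) := by
  have h : ∀ l : List V, ∃ v', ∀ w v, l = w ++ [v] → (G.existsTurn v → G.move v v') ∧
      ∀ r, v = U.pos w.length r → r.length = U.count w.length →
        U.count (w.length + 1) = U.count w.length + 1 → v' = U.pos (w.length + 1) (τ r :: r) := by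
    intro l
    rcases l.eq_nil_or_concat' with rfl | ⟨w, v, rfl⟩
    · exact ⟨G.init, fun w v h => by simp at h⟩
    · by_cases h : ∃ r, v = U.pos w.length r ∧ r.length = U.count w.length ∧
          U.count (w.length + 1) = U.count w.length + 1
      · obtain ⟨r, rfl, h1, h2⟩ := h
        refine ⟨U.pos (w.length + 1) (τ r :: r), fun w' v' hw => ?_⟩
        obtain ⟨rfl, h3⟩ := List.append_inj' hw rfl
        obtain rfl := (List.cons.inj h3).1
        refine ⟨fun _ => (U.move_choice _ _ h1 h2 _).2 ⟨_, rfl⟩, fun r' h4 h5 _ => ?_⟩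
        rw [U.pos_injective _ _ _ h1 h5 h4]
      · have h' : ∃ v', G.existsTurn v → G.move v v' := by
          by_cases hv : G.existsTurn v
          · exact (U.exists_move v hv).imp fun _ h _ => h
          · exact ⟨v, fun h => absurd h hv⟩
        obtain ⟨v', hv'⟩ := h'
        refine ⟨v', fun w' u hw => ?_⟩
        obtain ⟨rfl, h3⟩ := List.append_inj' hw rfl
        obtain rfl := (List.cons.inj h3).1
        exact ⟨hv', fun r h4 h5 h6 => absurd ⟨r, h4, h5, h6⟩ h⟩
  choose σ hσ using h
  exact ⟨σ, fun w v hv => (hσ _ w v rfl).1 hv, fun w r h1 h2 => (hσ _ w _ rfl).2 r rfl h1 h2⟩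

/-- Every sequence of legal moves from the initial position is the play of some branch. -/
theorem exists_eq_play {ρ : ℕ → V} (h0 : ρ 0 = G.init) (hρ : ∀ n, G.move (ρ n) (ρ (n + 1))) :
    ∃ b, ρ = U.play b := by
  have hX : ∀ n, ∃ r, r.length = U.count n ∧ ρ n = U.pos n r := by
    intro n
    induction n with
    | zero => exact ⟨[], by simp [U.count_zero], by rw [h0, U.pos_zero]⟩
    | succ n ih =>
      obtain ⟨r, h1, h2⟩ := ih
      have h := hρ n
      rw [h2] at h
      rcases U.count_succ n with hn | hn
      · rw [U.move_forced n r h1 hn] at h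
        exact ⟨r, by rw [h1, hn], h⟩
      · rw [U.move_choice n r h1 hn] at h
        obtain ⟨d, hd⟩ := h
        exact ⟨d :: r, by rw [List.length_cons, h1, hn], hd⟩
  choose X hX1 hX2 using hX
  refine ⟨fun m => (X (U.time m + 1)).head?.getD .L, funext fun n => ?_⟩
  rw [hX2, play]
  congr 1
  induction n with
  | zero =>
    rw [U.count_zero]
    exact List.length_eq_zero_iff.1 ((hX1 0).trans U.count_zero)
  | succ n ih =>
    have h := hρ n
    rw [hX2 n] at h
    rcases U.count_succ n with hn | hn
    · rw [U.move_forced n _ (hX1 n) hn, hX2 (n + 1)] at h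
      rw [hn, ← ih]
      exact U.pos_injective _ _ _ (hX1 _) (by rw [hX1 n, hn]) h
    · rw [U.move_choice n _ (hX1 n) hn, hX2 (n + 1)] at h
      obtain ⟨d, hd⟩ := h
      have h := U.pos_injective _ _ _ (hX1 _) (by rw [List.length_cons, hX1 n, hn]) hd
      rw [hn, initialSegment, ← ih, ← U.time_count n hn, h]
      rfl

theorem existsWins_iff : G.ExistsWins ↔
    WinsOnBinaryTree (fun r => G.existsTurn (U.pos (U.time r.length) r))
      (fun b => G.win (U.play b)) := by
  constructor
  · rintro ⟨σ, hσ, hwin⟩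
    have hτ : ∀ r : List Dir, ∃ d, G.existsTurn (U.pos (U.time r.length) r) →
        σ (U.history r) = U.pos (U.time r.length + 1) (d :: r) := by
      intro r
      by_cases hr : G.existsTurn (U.pos (U.time r.length) r)
      · obtain ⟨w, hw⟩ := U.history_eq r
        have h := hσ w _ hr
        rw [U.move_choice _ _ (U.count_time _).symm
          ((U.count_time_succ _).trans (by rw [U.count_time])), ← hw] at h
        obtain ⟨d, hd⟩ := h
        exact ⟨d, fun _ => hd⟩
      · exact ⟨.L, fun h => absurd h hr⟩
    choose τ hτ using hτ
    refine ⟨τ, fun b hb => hwin _ ⟨?_, U.move_play b, fun n hn => ?_⟩⟩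
    · rw [play, U.count_zero, initialSegment, U.pos_zero]
    · rcases U.count_succ n with h | h
      · -- at a forced move the strategy has no alternative
        have h1 := U.move_play b n
        have h2 := hσ ((List.range n).map (U.play b)) (U.play b n) hn
        rw [← List.map_singleton, ← List.map_append, ← List.range_succ] at h2
        rw [play, U.move_forced n _ (by simp) h] at h1 h2
        rw [h1, h2]
      · have ht := U.time_count n h
        have hn' := hn
        rw [play] at hn'
        have h1 := hτ (initialSegment b (U.count n))
        have h2 := hb (U.count n)
        rw [U.history_initialSegment] at h1
        simp only [length_initialSegment, ← ht] at h1 h2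
        rw [h1 hn', ← h2 hn', play, h]
        rfl
  · rintro ⟨τ, hτ⟩
    obtain ⟨σ, hσ, hσ'⟩ := U.exists_strategy τ
    refine ⟨σ, hσ, fun ρ hρ => ?_⟩
    obtain ⟨b, rfl⟩ := U.exists_eq_play hρ.init hρ.move
    refine hτ b fun m hm => ?_
    simp only [length_initialSegment] at hm
    have hp : U.play b (U.time m) = U.pos (U.time m) (initialSegment b m) := by
      rw [play, U.count_time]
    have h1 := hρ.follows (U.time m) (by rwa [hp])
    have h2 := hσ' ((List.range (U.time m)).map (U.play b)) (initialSegment b m)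
      (by simp [U.count_time]) (by simp [U.count_time, U.count_time_succ])
    rw [List.length_map, List.length_range] at h2
    rw [List.range_succ, List.map_append, List.map_singleton, hp, h2, play,
      U.count_time_succ] at h1
    have := U.pos_injective _ _ _ (by rw [length_initialSegment, U.count_time_succ])
      (by rw [List.length_cons, length_initialSegment, U.count_time_succ]) h1
    exact (List.cons.inj this).1

end Game.Unfolding

/-! ### The run of a game automaton on a tree -/

namespace Automaton

variable {Λ Q : Type*} {A : Automaton Λ Q} (hA : A.IsGame)

theorem HasTargets.unique {q : Q} {a : Λ} {q₁ q₂ q₁' q₂' : Q} (h : A.HasTargets q a q₁ q₂)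
    (h' : A.HasTargets q a q₁' q₂') : q₁ = q₁' ∧ q₂ = q₂' := by
  rcases h with h | h <;> rcases h' with h' | h' <;> rw [h] at h' <;>
    simp_all

namespace IsGame

/-- The state sent in direction `d` by the transition `δ(q,a)`. -/
def target (q : Q) (a : Λ) : Dir → Q
  | .L => (hA q a).choose
  | .R => (hA q a).choose_spec.choose

theorem hasTargets_target (q : Q) (a : Λ) :
    A.HasTargets q a (hA.target q a .L) (hA.target q a .R) :=
  (hA q a).choose_spec.choose_spec

theorem target_eq {q : Q} {a : Λ} {q₁ q₂ : Q} (h : A.HasTargets q a q₁ q₂) :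
    hA.target q a .L = q₁ ∧ hA.target q a .R = q₂ :=
  (hA.hasTargets_target q a).unique h

/-- The vertex `r` of the `Σ`-tree `t` as a vertex of the Markov branching play: the automaton state
reached at `r`, preceded by the list of the earlier states of the Markov branching play, the most
recent one first. Also `r` lists the most recent direction first, hence its label in `t` is
`t r.reverse`. -/
def vertex (t : LabelledTree Λ) : List Dir → List (Q ⊕ Q × Λ) × Q
  | [] => ([], A.q₀)
  | d :: r =>
    (.inr ((vertex t r).2, t r.reverse) :: .inl (vertex t r).2 :: (vertex t r).1,
      hA.target (vertex t r).2 (t r.reverse) d)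

/-- The automaton state in which the vertex `r` is reached. -/
def state (t : LabelledTree Λ) (r : List Dir) : Q := (hA.vertex t r).2

theorem state_cons (t : LabelledTree Λ) (d : Dir) (r : List Dir) :
    hA.state t (d :: r) = hA.target (hA.state t r) (t r.reverse) d := rfl

/-- It is up to `∃` to choose the direction at the vertex `r`. -/
def ExistsTurn (t : LabelledTree Λ) (r : List Dir) : Prop :=
  ∃ e₁ e₂, A.δ (hA.state t r) (t r.reverse) = .or e₁ e₂

/-- `∃` wins the game in which the players choose the successive directions of a branch of `t` and
the states visited along this branch have to satisfy the parity condition. Both the acceptance game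
and the game on the branching play given by `t` amount to this game. -/
def WinsOn (t : LabelledTree Λ) : Prop :=
  WinsOnBinaryTree (hA.ExistsTurn t) fun b =>
    MaxEven {k | ∃ᶠ n in Filter.atTop, A.π (hA.state t (initialSegment b n)) = k}

/-! ### The acceptance game -/

/-- The position of the acceptance game at time `n` if the directions `r` have been chosen before:
one round consists of the positions `⟨x, q⟩`, `⟨x, δ(q, t(x))⟩` and `⟨x, (d, q')⟩`. -/
def acceptancePos (t : LabelledTree Λ) (n : ℕ) (r : List Dir) : Position Q :=
  match n % 3, r with
  | 0, r => (r.reverse, .inl (hA.state t r))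
  | 1, r => (r.reverse, .inr (A.δ (hA.state t r) (t r.reverse)))
  | _, d :: r => (r.reverse, .inr (.atom (d, hA.state t (d :: r))))
  | _, [] => ([], .inl A.q₀)

theorem acceptancePos_zero_mod (t : LabelledTree Λ) (m : ℕ) (r : List Dir) :
    hA.acceptancePos t (3 * m) r = (r.reverse, .inl (hA.state t r)) := by
  have h : 3 * m % 3 = 0 := by omega
  simp [acceptancePos, h]

theorem acceptancePos_one_mod (t : LabelledTree Λ) (m : ℕ) (r : List Dir) :
    hA.acceptancePos t (3 * m + 1) r =
      (r.reverse, .inr (A.δ (hA.state t r) (t r.reverse))) := by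
  have h : (3 * m + 1) % 3 = 1 := by omega
  simp [acceptancePos, h]

theorem acceptancePos_two_mod (t : LabelledTree Λ) (m : ℕ) (d : Dir) (r : List Dir) :
    hA.acceptancePos t (3 * m + 2) (d :: r) =
      (r.reverse, .inr (.atom (d, hA.state t (d :: r)))) := by
  have h : (3 * m + 2) % 3 = 2 := by omega
  simp [acceptancePos, h]

theorem acceptancePos_injective (t : LabelledTree Λ) (n : ℕ) {r r' : List Dir}
    (hr : r.length = (n + 1) / 3) (hr' : r'.length = (n + 1) / 3)
    (h : hA.acceptancePos t n r = hA.acceptancePos t n r') : r = r' := by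
  obtain ⟨m, rfl | rfl | rfl⟩ : ∃ m, n = 3 * m ∨ n = 3 * m + 1 ∨ n = 3 * m + 2 :=
    ⟨n / 3, by omega⟩
  · rw [acceptancePos_zero_mod, acceptancePos_zero_mod] at h
    exact List.reverse_injective (Prod.mk.inj h).1
  · rw [acceptancePos_one_mod, acceptancePos_one_mod] at h
    exact List.reverse_injective (Prod.mk.inj h).1
  · obtain ⟨d, r, rfl⟩ := List.exists_cons_of_length_pos (l := r) (by omega)
    obtain ⟨d', r', rfl⟩ := List.exists_cons_of_length_pos (l := r') (by omega)
    rw [acceptancePos_two_mod, acceptancePos_two_mod] at h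
    simp only [Prod.mk.injEq, List.reverse_inj, Sum.inr.injEq, DL.atom.injEq] at h
    rw [h.1, h.2.1]

theorem move_read_iff (t : LabelledTree Λ) (x : List Dir) (q : Q) (v : Position Q) :
    A.Move t (x, .inl q) v ↔ v = (x, .inr (A.δ q (t x))) := by
  constructor
  · rintro ⟨⟩
    rfl
  · rintro rfl
    exact .read x q

theorem move_atom_iff (t : LabelledTree Λ) (x : List Dir) (d : Dir) (q : Q) (v : Position Q) :
    A.Move t (x, .inr (.atom (d, q))) v ↔ v = (x ++ [d], .inl q) := by
  constructor
  · rintro ⟨⟩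
    rfl
  · rintro rfl
    exact .step x d q

theorem move_transition_iff (t : LabelledTree Λ) (x : List Dir) (q : Q) (a : Λ)
    (v : Position Q) :
    A.Move t (x, .inr (A.δ q a)) v ↔ ∃ d, v = (x, .inr (.atom (d, hA.target q a d))) := by
  constructor
  · intro h
    rcases hA.hasTargets_target q a with h' | h' <;> rw [h'] at h <;> cases h
    exacts [⟨.L, rfl⟩, ⟨.R, rfl⟩, ⟨.L, rfl⟩, ⟨.R, rfl⟩]
  · rintro ⟨d, rfl⟩
    rcases hA.hasTargets_target q a with h' | h' <;> rw [h'] <;> cases d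
    exacts [.orLeft _ _ _, .orRight _ _ _, .andLeft _ _ _, .andRight _ _ _]

/-- The plays of the acceptance game correspond to the branches of the full binary tree. -/
def acceptanceUnfolding (t : LabelledTree Λ) : (A.acceptanceGame t).Unfolding where
  pos := hA.acceptancePos t
  count n := (n + 1) / 3
  time m := 3 * m + 1
  count_zero := rfl
  count_succ n := by omega
  count_time m := by omega
  count_time_succ m := by omega
  time_count n h := by omega
  pos_zero := rfl
  pos_injective n _ _ := hA.acceptancePos_injective t n
  move_forced n r hr hn v := by
    obtain ⟨m, rfl | rfl⟩ : ∃ m, n = 3 * m ∨ n = 3 * m + 2 := ⟨n / 3, by omega⟩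
    · rw [acceptancePos_zero_mod, acceptancePos_one_mod]
      exact move_read_iff t _ _ v
    · obtain ⟨d, r, rfl⟩ := List.exists_cons_of_length_pos (l := r) (by omega)
      rw [acceptancePos_two_mod, show 3 * m + 2 + 1 = 3 * (m + 1) by ring,
        acceptancePos_zero_mod, List.reverse_cons]
      exact move_atom_iff t _ _ _ v
  move_choice n r hr hn v := by
    obtain ⟨m, rfl⟩ : ∃ m, n = 3 * m + 1 := ⟨n / 3, by omega⟩
    simp only [acceptancePos_one_mod, acceptancePos_two_mod]
    exact hA.move_transition_iff t _ _ _ v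
  exists_move := by
    rintro v ⟨x, e₁, e₂, rfl⟩
    exact ⟨_, .orLeft x e₁ e₂⟩

/-- Since there are finitely many states, a priority occurs infinitely often if and only if it is
the priority of a state which occurs infinitely often. -/
theorem image_infStates_play [Finite Q] (t : LabelledTree Λ) (b : ℕ → Dir) :
    A.π '' infStates ((hA.acceptanceUnfolding t).play b) =
      {k | ∃ᶠ n in Filter.atTop, A.π (hA.state t (initialSegment b n)) = k} := by
  have h : ∀ q, q ∈ infStates ((hA.acceptanceUnfolding t).play b) ↔
      ∃ᶠ n in Filter.atTop, hA.state t (initialSegment b n) = q := by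
    intro q
    have hplay : ∀ n, (hA.acceptanceUnfolding t).play b n =
        hA.acceptancePos t n (initialSegment b ((n + 1) / 3)) := fun _ => rfl
    simp only [infStates, Set.mem_ofPred_eq, Filter.frequently_atTop, hplay]
    constructor
    · intro h N
      obtain ⟨n, hn, x, hx⟩ := h (3 * N)
      obtain ⟨m, rfl | rfl | rfl⟩ : ∃ m, n = 3 * m ∨ n = 3 * m + 1 ∨ n = 3 * m + 2 :=
        ⟨n / 3, by omega⟩
      · rw [acceptancePos_zero_mod, show (3 * m + 1) / 3 = m by omega] at hx
        simp only [Prod.mk.injEq, Sum.inl.injEq] at hx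
        exact ⟨m, by omega, hx.2⟩
      · simp [acceptancePos_one_mod] at hx
      · rw [show (3 * m + 2 + 1) / 3 = m + 1 by omega, initialSegment,
          acceptancePos_two_mod] at hx
        simp at hx
    · intro h N
      obtain ⟨m, hm, hq⟩ := h N
      refine ⟨3 * m, by omega, (initialSegment b m).reverse, ?_⟩
      rw [acceptancePos_zero_mod, show (3 * m + 1) / 3 = m by omega, hq]
  ext k
  simp only [Set.mem_image, h, Set.mem_ofPred_eq]
  constructor
  · rintro ⟨q, hq, rfl⟩
    exact hq.mono fun n hn => by rw [hn]
  · intro hk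
    by_contra! hq
    refine hk ?_
    have h' : ∀ q, ∀ᶠ n in Filter.atTop,
        ¬ (hA.state t (initialSegment b n) = q ∧ A.π q = k) := by
      intro q
      by_cases hqk : A.π q = k
      · by_contra hf
        refine hq q (Filter.Frequently.mono hf fun n hn => ?_) hqk
        exact hn.1
      · exact Filter.Eventually.of_forall fun n hn => hqk hn.2
    filter_upwards [Filter.eventually_all.2 h'] with n hn hkn
    exact hn _ ⟨rfl, hkn⟩

theorem mem_language_iff [Finite Q] (t : LabelledTree Λ) : t ∈ A.language ↔ hA.WinsOn t := by
  change (A.acceptanceGame t).ExistsWins ↔ _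
  rw [(hA.acceptanceUnfolding t).existsWins_iff, WinsOn]
  have h1 : (fun r : List Dir => (A.acceptanceGame t).existsTurn
      ((hA.acceptanceUnfolding t).pos ((hA.acceptanceUnfolding t).time r.length) r)) =
      hA.ExistsTurn t := by
    ext r
    change (∃ x e₁ e₂, hA.acceptancePos t (3 * r.length + 1) r = (x, .inr (.or e₁ e₂))) ↔ _
    simp [acceptancePos_one_mod, ExistsTurn]
  have h2 : (fun b => (A.acceptanceGame t).win ((hA.acceptanceUnfolding t).play b)) = fun b =>
      MaxEven {k | ∃ᶠ n in Filter.atTop, A.π (hA.state t (initialSegment b n)) = k} := by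
    ext b
    rw [← hA.image_infStates_play t b]
    rfl
  rw [h1, h2]

end IsGame

/-! ### Duplication of the states -/

theorem HasTargets.duplicate {q : Q} {a : Λ} {q₁ q₂ : Q} (h : A.HasTargets q a q₁ q₂) (d : Dir) :
    A.duplicate.HasTargets (q, d) a (q₁, .L) (q₂, .R) := by
  rcases h with h | h
  · exact Or.inl (by simp [Automaton.duplicate, h, DL.map])
  · exact Or.inr (by simp [Automaton.duplicate, h, DL.map])

namespace IsGame

theorem target_duplicate (q : Q × Dir) (a : Λ) (d : Dir) :
    hA.duplicate.target q a d = (hA.target q.1 a d, d) := by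
  have h := hA.duplicate.target_eq ((hA.hasTargets_target q.1 a).duplicate q.2)
  cases d
  exacts [h.1, h.2]

theorem targetsDistinct_duplicate (hA : A.IsGame) : A.duplicate.TargetsDistinct := by
  intro q a q₁ q₂ h heq
  have h' := h.unique ((hA.hasTargets_target q.1 a).duplicate q.2)
  have := (h'.1.symm.trans heq).trans h'.2
  cases (Prod.mk.inj this).2

theorem state_duplicate (t : LabelledTree Λ) (r : List Dir) :
    (hA.duplicate.state t r).1 = hA.state t r := by
  induction r with
  | nil => rfl
  | cons d r ih => rw [state_cons, state_cons, target_duplicate, ih]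

theorem winsOn_duplicate (t : LabelledTree Λ) : hA.duplicate.WinsOn t ↔ hA.WinsOn t := by
  have h1 : hA.duplicate.ExistsTurn t = hA.ExistsTurn t := by
    ext r
    have h : A.duplicate.δ (hA.duplicate.state t r) (t r.reverse) =
        (A.δ (hA.state t r) (t r.reverse)).map fun x => (x.1, (x.2, x.1)) := by
      rw [← hA.state_duplicate]
      rfl
    rw [ExistsTurn, ExistsTurn, h]
    cases A.δ (hA.state t r) (t r.reverse) <;> simp [DL.map]
  have h2 : ∀ r, A.duplicate.π (hA.duplicate.state t r) = A.π (hA.state t r) := by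
    intro r
    rw [← hA.state_duplicate]
    rfl
  simp only [WinsOn, h1, h2]

theorem language_duplicate (hA : A.IsGame) [Finite Q] : A.duplicate.language = A.language := by
  ext t
  rw [hA.duplicate.mem_language_iff, hA.mem_language_iff, winsOn_duplicate]

end IsGame

end Automaton

open MeasureTheory

/-! ### Cylinders and product measures -/

/-- A measure on a product of copies of a countable space is determined by the cylinders which fix
all coordinates in a set from a cofinal family of finite sets of coordinates. -/
theorem eq_infinitePi_of_cylinder {ι α : Type*} [Countable α] [Nonempty α] [MeasurableSpace α]
    [MeasurableSingletonClass α] (μ : ι → Measure α) [∀ i, IsProbabilityMeasure (μ i)]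
    {ν : Measure (ι → α)}
    (h : ∀ s : Finset ι, ∃ D : Finset ι, s ⊆ D ∧
      ∀ f : ι → α, ν (Set.pi D fun i => {f i}) = ∏ i ∈ D, μ i {f i}) :
    ν = Measure.infinitePi μ := by
  classical
  refine Measure.eq_infinitePi μ fun s t ht => ?_
  rw [← Measure.infinitePi_pi μ fun i _ => ht i]
  obtain ⟨D, hsD, hD⟩ := h s
  have hr : Measurable (D.restrict : (ι → α) → D → α) := by fun_prop
  have hmap : ν.map D.restrict = (Measure.infinitePi μ).map D.restrict := by
    refine Measure.ext_of_singleton fun g => ?_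
    have hg : (D.restrict : (ι → α) → D → α) ⁻¹' {g} =
        Set.pi D fun i => {if hi : i ∈ D then g ⟨i, hi⟩ else Classical.arbitrary α} := by
      ext f
      simp only [Set.mem_preimage, Set.mem_singleton_iff, funext_iff, Set.mem_pi,
        Finset.mem_coe, Subtype.forall, Finset.restrict]
      exact forall₂_congr fun i hi => by rw [dif_pos hi]
    rw [Measure.map_apply hr (measurableSet_singleton g),
      Measure.map_apply hr (measurableSet_singleton g), hg, hD,
      Measure.infinitePi_pi μ fun i _ => measurableSet_singleton _]
  have hst : Set.pi s t = (D.restrict : (ι → α) → D → α) ⁻¹'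
      Set.pi {i | (i : ι) ∈ s} fun i => t i := by
    ext f
    simp only [Set.mem_preimage, Set.mem_pi, Finset.mem_coe, Subtype.forall, Finset.restrict,
      Set.mem_ofPred_eq]
    exact ⟨fun h i _ hi => h i hi, fun h i hi => h i (hsD hi) hi⟩
  have hm : MeasurableSet (Set.pi {i : D | (i : ι) ∈ s} fun i => t i) :=
    MeasurableSet.pi (Set.to_countable _) fun i _ => ht i
  rw [hst, ← Measure.map_apply hr hm, ← Measure.map_apply hr hm, hmap]

/-! ### Branching plays -/

theorem FinPath.extend_inj {S : Type*} {x y : FinPath S} {s s' : S} :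
    x.extend s = y.extend s' ↔ x = y ∧ s = s' := by
  simp only [FinPath.extend, List.cons.injEq, Prod.ext_iff]
  tauto

namespace MBP

variable {S : Type*} (M : MBP S)

/-- Every branching play is grown from some choices. -/
theorem generate_surjective (s₀ : S) : Function.Surjective (M.generate s₀) := by
  classical
  intro T
  have h : ∀ x : M.ProbVertex, ∃ s : {s // M.E x.1.2 s}, x.1 ∈ T.1 → x.1.extend s ∈ T.1 := by
    intro x
    by_cases hx : x.1 ∈ T.1
    · obtain ⟨s, hs, -⟩ := T.2.prob x.1 hx x.2
      exact ⟨⟨s, (T.2.parent _ _ hs).2⟩, fun _ => hs⟩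
    · obtain ⟨s, hs⟩ := M.exists_succ x.1.2
      exact ⟨⟨s, hs⟩, fun h => absurd h hx⟩
  choose c hc using h
  refine ⟨c, Subtype.ext (Set.ext ?_)⟩
  rintro ⟨h, s⟩
  change M.Generated s₀ c h s ↔ (h, s) ∈ T.1
  induction h generalizing s with
  | nil => exact (T.2.root s).symm
  | cons r h ih =>
    change M.Generated s₀ c h r ∧ _ ↔ FinPath.extend (h, r) s ∈ T.1
    rw [ih]
    by_cases hr : M.kind r = .prob
    · rw [dif_pos hr]
      constructor
      · rintro ⟨h1, rfl⟩
        exact hc ⟨(h, r), hr⟩ h1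
      · intro h1
        have h2 := (T.2.parent _ _ h1).1
        exact ⟨h2, (T.2.prob _ h2 hr).unique (hc ⟨(h, r), hr⟩ h2) h1⟩
    · rw [dif_neg hr]
      exact ⟨fun h1 => T.2.branch _ h1.1 hr _ h1.2, fun h1 => T.2.parent _ _ h1⟩

theorem measurableSet_mem_branchingPlay (s₀ : S) (x : FinPath S) :
    MeasurableSet {T : M.BranchingPlay s₀ | x ∈ T.1} :=
  measurable_subtype_coe (measurableSet_setOfPred.2 (measurable_set_mem x))

end MBP

namespace Automaton.IsGame

variable {Λ Q : Type*} {A : Automaton Λ Q} (hA : A.IsGame)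

/-! ### Trees and choices -/

theorem edge_inl_iff {q : Q} {s : Q ⊕ Q × Λ} :
    A.Edge (.inl q) s ↔ ∃ a, s = .inr (q, a) := by
  constructor
  · rintro ⟨⟩
    exact ⟨_, rfl⟩
  · rintro ⟨a, rfl⟩
    exact .letter q a

theorem edge_inr_iff {q : Q} {a : Λ} {s : Q ⊕ Q × Λ} :
    A.Edge (.inr (q, a)) s ↔ ∃ d, s = .inl (hA.target q a d) := by
  constructor
  · rintro (_ | ⟨_, _, q₁, q₂, h⟩ | ⟨_, _, q₁, q₂, h⟩)
    exacts [⟨.L, by rw [(hA.target_eq h).1]⟩, ⟨.R, by rw [(hA.target_eq h).2]⟩]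
  · rintro ⟨_ | _, rfl⟩
    exacts [.left _ _ _ _ (hA.hasTargets_target q a), .right _ _ _ _ (hA.hasTargets_target q a)]

theorem stateKind_inr_ne (q : Q) (a : Λ) : A.stateKind (.inr (q, a)) ≠ .prob := by
  cases hd : A.δ q a <;> simp [stateKind, hd]

open Classical in
/-- The directions, the most recent one first, which lead to the vertex of a branching play labelled
by `s_q` and with earlier states `h`. -/
def directions : List (Q ⊕ Q × Λ) → Q → List Dir
  | .inr (q', a) :: _ :: h, q =>
    (if q = hA.target q' a .L then .L else .R) :: directions h q'
  | _, _ => []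

theorem directions_vertex (hd : A.TargetsDistinct) (t : LabelledTree Λ) (r : List Dir) :
    hA.directions (hA.vertex t r).1 (hA.vertex t r).2 = r := by
  induction r with
  | nil => rfl
  | cons d r ih =>
    rw [vertex, directions, ih]
    have h := hd _ _ _ _ (hA.hasTargets_target (hA.vertex t r).2 (t r.reverse))
    cases d
    · simp
    · simp [h.symm]

theorem measurable_apply (x : List Dir) :
    Measurable[_, ⊤] fun t : LabelledTree Λ => t x :=
  @measurable_pi_apply (List Dir) (fun _ => Λ) (fun _ => ⊤) x

/-- The choice of the letter `a` at a vertex labelled by `s_q`. -/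
def letterChoice (q : Q) (a : Λ) : {s // A.Edge (.inl q) s} := ⟨.inr (q, a), .letter q a⟩

theorem letterChoice_injective (q : Q) :
    Function.Injective (letterChoice (A := A) (Λ := Λ) q) := by
  intro a a' h
  have h := congrArg Subtype.val h
  simpa [letterChoice] using h

theorem exists_eq_letterChoice {q : Q} (s : {s // A.Edge (.inl q) s}) :
    ∃ a, s = letterChoice q a := by
  obtain ⟨a, ha⟩ := edge_inl_iff.1 s.2
  exact ⟨a, Subtype.ext ha⟩

/-- The vertex `r` of `t` as a vertex labelled by a state `s_q` of the branching play given by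
`t`. -/
def stateNode (t : LabelledTree Λ) (r : List Dir) : FinPath (Q ⊕ Q × Λ) :=
  ((hA.vertex t r).1, .inl (hA.state t r))

/-- The child, labelled by a state `s_{q,a}`, of the vertex `stateNode t r`. -/
def letterNode (t : LabelledTree Λ) (r : List Dir) : FinPath (Q ⊕ Q × Λ) :=
  (hA.stateNode t r).extend (.inr (hA.state t r, t r.reverse))

theorem stateNode_cons (t : LabelledTree Λ) (d : Dir) (r : List Dir) :
    hA.stateNode t (d :: r) = (hA.letterNode t r).extend (.inl (hA.state t (d :: r))) := rfl

theorem stateNode_injective (hd : A.TargetsDistinct) (t : LabelledTree Λ) :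
    Function.Injective (hA.stateNode t) := by
  intro r r' h
  have h1 : hA.vertex t r = hA.vertex t r' := by
    simp only [stateNode, state, Prod.mk.injEq, Sum.inl.injEq] at h
    exact Prod.ext h.1 h.2
  rw [← hA.directions_vertex hd t r, h1, hA.directions_vertex hd]

theorem letterNode_injective (hd : A.TargetsDistinct) (t : LabelledTree Λ) :
    Function.Injective (hA.letterNode t) := fun _ _ h =>
  hA.stateNode_injective hd t (FinPath.extend_inj.1 h).1

variable [Fintype Λ] [Nonempty Λ]

/-- A vertex of the branching plays of the associated Markov branching play which is labelled by a
state of the form `s_q`. -/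
def probVertex (v : List (Q ⊕ Q × Λ) × Q) : (A.toMBP hA).ProbVertex := ⟨(v.1, .inl v.2), rfl⟩

theorem probVertex_injective : Function.Injective hA.probVertex := by
  rintro ⟨h, q⟩ ⟨h', q'⟩ heq
  have heq := congrArg Subtype.val heq
  simpa [probVertex] using heq

theorem exists_eq_probVertex (x : (A.toMBP hA).ProbVertex) : ∃ v, x = hA.probVertex v := by
  obtain ⟨⟨h, q | ⟨q, a⟩⟩, hx⟩ := x
  · exact ⟨(h, q), rfl⟩
  · exact absurd hx (stateKind_inr_ne q a)

/-- The choice made by `c` at the vertex `v`. -/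
def choiceAt (c : (A.toMBP hA).Choice) (v : List (Q ⊕ Q × Λ) × Q) :
    {s // A.Edge (.inl v.2) s} := c (hA.probVertex v)

/-- The letter chosen at the vertex `v`. -/
def letter (c : (A.toMBP hA).Choice) (v : List (Q ⊕ Q × Λ) × Q) : Λ :=
  (exists_eq_letterChoice (hA.choiceAt c v)).choose

theorem choiceAt_eq (c : (A.toMBP hA).Choice) (v : List (Q ⊕ Q × Λ) × Q) :
    hA.choiceAt c v = letterChoice v.2 (hA.letter c v) :=
  (exists_eq_letterChoice (hA.choiceAt c v)).choose_spec

/-- The choices by which the branching play associated with the tree `t` is grown: at a vertex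
reached by the directions `r`, the label of the vertex `r` of `t`. -/
def choiceOf (t : LabelledTree Λ) : (A.toMBP hA).Choice
  | ⟨(h, .inl q), _⟩ => letterChoice q (t (hA.directions h q).reverse)
  | ⟨(_, .inr (q, a)), hx⟩ => absurd hx (stateKind_inr_ne q a)

theorem choiceAt_choiceOf (t : LabelledTree Λ) (v : List (Q ⊕ Q × Λ) × Q) :
    hA.choiceAt (hA.choiceOf t) v = letterChoice v.2 (t (hA.directions v.1 v.2).reverse) := rfl

theorem choiceAt_choiceOf_vertex (hd : A.TargetsDistinct) (t : LabelledTree Λ) (r : List Dir) :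
    hA.choiceAt (hA.choiceOf t) (hA.vertex t r) = letterChoice (hA.vertex t r).2 (t r.reverse) := by
  rw [choiceAt_choiceOf, hA.directions_vertex hd]

theorem letter_choiceOf (t : LabelledTree Λ) (v : List (Q ⊕ Q × Λ) × Q) :
    hA.letter (hA.choiceOf t) v = t (hA.directions v.1 v.2).reverse :=
  letterChoice_injective v.2 (hA.choiceAt_eq _ v).symm

/-- The vertex of the branching play grown with the choices `c` which is reached by the given
directions, the most recent one first. -/
def chosenVertex (c : (A.toMBP hA).Choice) : List Dir → List (Q ⊕ Q × Λ) × Q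
  | [] => ([], A.q₀)
  | d :: r =>
    (.inr ((chosenVertex c r).2, hA.letter c (chosenVertex c r)) ::
        .inl (chosenVertex c r).2 :: (chosenVertex c r).1,
      hA.target (chosenVertex c r).2 (hA.letter c (chosenVertex c r)) d)

/-- The tree of the letters chosen in the branching play grown with the choices `c`. -/
def treeOf (c : (A.toMBP hA).Choice) : LabelledTree Λ := fun x =>
  hA.letter c (hA.chosenVertex c x.reverse)

theorem vertex_treeOf (c : (A.toMBP hA).Choice) (r : List Dir) :
    hA.vertex (hA.treeOf c) r = hA.chosenVertex c r := by
  induction r with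
  | nil => rfl
  | cons d r ih => simp only [vertex, chosenVertex, ih, treeOf, List.reverse_reverse]

theorem choiceAt_vertex_treeOf (c : (A.toMBP hA).Choice) (r : List Dir) :
    hA.choiceAt c (hA.vertex (hA.treeOf c) r) =
      letterChoice (hA.vertex (hA.treeOf c) r).2 (hA.treeOf c r.reverse) := by
  rw [choiceAt_eq, vertex_treeOf, treeOf, List.reverse_reverse]

theorem treeOf_choiceOf (hd : A.TargetsDistinct) (t : LabelledTree Λ) :
    hA.treeOf (hA.choiceOf t) = t := by
  have h : ∀ r, hA.chosenVertex (hA.choiceOf t) r = hA.vertex t r := by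
    intro r
    induction r with
    | nil => rfl
    | cons d r ih => simp only [vertex, chosenVertex, ih, letter_choiceOf, directions_vertex hA hd]
  funext x
  rw [treeOf, h, letter_choiceOf, hA.directions_vertex hd, List.reverse_reverse]

theorem mem_generate (c : (A.toMBP hA).Choice) (x : FinPath (Q ⊕ Q × Λ)) :
    x ∈ ((A.toMBP hA).generate (.inl A.q₀) c).1 ↔
      ∃ r, x = hA.stateNode (hA.treeOf c) r ∨ x = hA.letterNode (hA.treeOf c) r := by
  have hT := ((A.toMBP hA).generate (.inl A.q₀) c).2
  have hprob : ∀ x ∈ ((A.toMBP hA).generate (.inl A.q₀) c).1,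
      ∀ hx : (A.toMBP hA).kind x.2 = .prob, ∀ s,
      x.extend s ∈ ((A.toMBP hA).generate (.inl A.q₀) c).1 ↔ s = (c ⟨x, hx⟩).1 := by
    intro x hxT hx s
    constructor
    · rintro ⟨-, h⟩
      rw [dif_pos hx] at h
      exact h.symm
    · rintro rfl
      refine ⟨hxT, ?_⟩
      rw [dif_pos hx]
      rfl
  have hstate : ∀ r, hA.stateNode (hA.treeOf c) r ∈
      ((A.toMBP hA).generate (.inl A.q₀) c).1 → ∀ s,
      (hA.stateNode (hA.treeOf c) r).extend s ∈ ((A.toMBP hA).generate (.inl A.q₀) c).1 ↔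
        s = .inr (hA.state (hA.treeOf c) r, hA.treeOf c r.reverse) := by
    intro r hr s
    rw [hprob _ hr rfl]
    change s = (hA.choiceAt c (hA.vertex (hA.treeOf c) r)).1 ↔ _
    rw [choiceAt_vertex_treeOf]
    rfl
  constructor
  · obtain ⟨h, s⟩ := x
    induction h generalizing s with
    | nil =>
      intro hx
      exact ⟨[], Or.inl (by rw [(hT.root s).1 hx]; rfl)⟩
    | cons s' h ih =>
      intro hx
      have hx' := hT.parent (h, s') s hx
      obtain ⟨r, hr | hr⟩ := ih s' hx'.1
      · refine ⟨r, Or.inr ?_⟩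
        change FinPath.extend (h, s') s ∈ _ at hx
        rw [hr] at hx hx'
        change FinPath.extend (h, s') s = _
        rw [hr, (hstate r hx'.1 s).1 hx, letterNode]
      · rw [hr] at hx'
        obtain ⟨d, hd⟩ := hA.edge_inr_iff.1 hx'.2
        refine ⟨d :: r, Or.inl ?_⟩
        change FinPath.extend (h, s') s = _
        rw [hr, hd, stateNode_cons, state_cons]
  · have h : ∀ r, hA.stateNode (hA.treeOf c) r ∈ ((A.toMBP hA).generate (.inl A.q₀) c).1 := by
      intro r
      induction r with
      | nil => exact (hT.root _).2 rfl
      | cons d r ih =>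
        rw [stateNode_cons]
        exact hT.branch _ ((hstate r ih _).2 rfl) (stateKind_inr_ne _ _) _
          (hA.edge_inr_iff.2 ⟨d, rfl⟩)
    rintro ⟨r, rfl | rfl⟩
    exacts [h r, (hstate r (h r) _).2 rfl]

/-! ### The bijection between trees and branching plays -/

/-- The branching play associated with the tree `t`. -/
def playOf (t : LabelledTree Λ) : (A.toMBP hA).BranchingPlay (.inl A.q₀) :=
  (A.toMBP hA).generate (.inl A.q₀) (hA.choiceOf t)

theorem mem_playOf (hd : A.TargetsDistinct) (t : LabelledTree Λ) (x : FinPath (Q ⊕ Q × Λ)) :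
    x ∈ (hA.playOf t).1 ↔ ∃ r, x = hA.stateNode t r ∨ x = hA.letterNode t r := by
  rw [playOf, mem_generate, hA.treeOf_choiceOf hd]

theorem playOf_treeOf (hd : A.TargetsDistinct) (c : (A.toMBP hA).Choice) :
    hA.playOf (hA.treeOf c) = (A.toMBP hA).generate (.inl A.q₀) c :=
  Subtype.ext (Set.ext fun x => by rw [hA.mem_playOf hd, mem_generate])

/-- The label of a vertex of the tree can be read off the branching play. -/
theorem apply_eq_iff_mem_playOf (hd : A.TargetsDistinct) (t : LabelledTree Λ) (x : List Dir)
    (a : Λ) : t x = a ↔ ∃ h q, hA.directions h q = x.reverse ∧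
      (.inl q :: h, .inr (q, a)) ∈ (hA.playOf t).1 := by
  simp only [hA.mem_playOf hd]
  constructor
  · rintro rfl
    refine ⟨_, _, hA.directions_vertex hd t x.reverse, x.reverse, Or.inr ?_⟩
    rw [letterNode, List.reverse_reverse]
    rfl
  · rintro ⟨h, q, hx, r, hr | hr⟩
    · simp [stateNode] at hr
    · simp only [letterNode, stateNode, FinPath.extend, Prod.mk.injEq, List.cons.injEq,
        Sum.inl.injEq, Sum.inr.injEq] at hr
      obtain ⟨⟨rfl, rfl⟩, -, rfl⟩ := hr
      have h : r = x.reverse := (hA.directions_vertex hd t r).symm.trans hx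
      rw [h, List.reverse_reverse]

theorem playOf_injective (hd : A.TargetsDistinct) : Function.Injective hA.playOf := by
  intro t t' h
  funext x
  rw [hA.apply_eq_iff_mem_playOf hd, h, ← hA.apply_eq_iff_mem_playOf hd]

theorem playOf_surjective (hd : A.TargetsDistinct) : Function.Surjective hA.playOf := by
  intro T
  obtain ⟨c, rfl⟩ := (A.toMBP hA).generate_surjective _ T
  exact ⟨_, hA.playOf_treeOf hd c⟩

theorem measurable_choiceOf : Measurable hA.choiceOf := by
  refine @measurable_pi_lambda _ _ _ _ (fun _ => ⊤) _ fun x => ?_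
  obtain ⟨v, rfl⟩ := hA.exists_eq_probVertex x
  exact (@measurable_from_top _ _ ⊤ (letterChoice (A := A) v.2)).comp (measurable_apply _)

theorem measurable_playOf : Measurable hA.playOf :=
  ((A.toMBP hA).measurable_generate _).comp hA.measurable_choiceOf

theorem playOf_bijective (hd : A.TargetsDistinct) : Function.Bijective hA.playOf :=
  ⟨hA.playOf_injective hd, hA.playOf_surjective hd⟩

/-- The bijection from trees to branching plays. -/
def playEquiv [Finite Q] (hd : A.TargetsDistinct) :
    LabelledTree Λ ≃ᵐ (A.toMBP hA).BranchingPlay (.inl A.q₀) where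
  toEquiv := Equiv.ofBijective hA.playOf (hA.playOf_bijective hd)
  measurable_toFun := hA.measurable_playOf
  measurable_invFun := by
    have : Countable Q := Finite.to_countable
    refine @measurable_pi_lambda _ _ _ _ (fun _ => ⊤) _ fun x => ?_
    refine @measurable_to_countable' _ _ ⊤ _ _ _ fun a => ?_
    have h : (fun T => (Equiv.ofBijective hA.playOf
        (hA.playOf_bijective hd)).symm T x) ⁻¹' {a} =
        ⋃ (h) (q) (_ : hA.directions h q = x.reverse),
          {T | ((.inl q :: h, .inr (q, a)) : FinPath (Q ⊕ Q × Λ)) ∈ T.1} := by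
      ext T
      obtain ⟨t, rfl⟩ := hA.playOf_surjective hd T
      rw [Set.mem_preimage, Set.mem_singleton_iff, Equiv.ofBijective_symm_apply_apply,
        hA.apply_eq_iff_mem_playOf hd]
      simp
    refine h ▸ MeasurableSet.iUnion fun h => MeasurableSet.iUnion fun q =>
      MeasurableSet.iUnion fun _ => (A.toMBP hA).measurableSet_mem_branchingPlay _ _

theorem playEquiv_apply [Finite Q] (hd : A.TargetsDistinct) (t : LabelledTree Λ) :
    hA.playEquiv hd t = hA.playOf t := rfl

theorem measurable_treeOf [Finite Q] (hd : A.TargetsDistinct) : Measurable hA.treeOf := by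
  have h : hA.treeOf = (hA.playEquiv hd).symm ∘ (A.toMBP hA).generate (.inl A.q₀) := by
    funext c
    rw [Function.comp_apply, ← hA.playOf_treeOf hd, ← hA.playEquiv_apply hd,
      MeasurableEquiv.symm_apply_apply]
  rw [h]
  exact (hA.playEquiv hd).symm.measurable.comp ((A.toMBP hA).measurable_generate _)

/-! ### The law of the chosen letters -/

/-- The choices `c` yield a tree which agrees with `t` on a set of vertices closed under prefixes if
and only if the choices at the corresponding vertices of the branching play of `t` are those given
by `t`. As these vertices depend on `t` only, this turns an event about an adaptively explored tree
into a cylinder of the space of choices. -/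
theorem treeOf_eqOn_iff (hd : A.TargetsDistinct) {D : Set (List Dir)}
    (hD : ∀ x d, x ++ [d] ∈ D → x ∈ D) (c : (A.toMBP hA).Choice) (t : LabelledTree Λ) :
    (∀ x ∈ D, hA.treeOf c x = t x) ↔
      ∀ x ∈ D, hA.choiceAt c (hA.vertex t x.reverse) =
        hA.choiceAt (hA.choiceOf t) (hA.vertex t x.reverse) := by
  have hv : (∀ r : List Dir, r.reverse ∈ D → hA.vertex (hA.treeOf c) r = hA.vertex t r →
      hA.treeOf c r.reverse = t r.reverse) →
      ∀ r : List Dir, r.reverse ∈ D → hA.vertex (hA.treeOf c) r = hA.vertex t r := by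
    intro h r
    induction r with
    | nil => exact fun _ => rfl
    | cons d r ih =>
      intro hr
      rw [List.reverse_cons] at hr
      have hr' := hD _ _ hr
      rw [vertex, vertex, ih hr', h r hr' (ih hr')]
  constructor
  · intro h x hx
    have hx' : x.reverse.reverse ∈ D := by rwa [List.reverse_reverse]
    have h1 := hA.choiceAt_vertex_treeOf c x.reverse
    rwa [hv (fun r hr _ => h _ hr) _ hx', h _ hx', ← hA.choiceAt_choiceOf_vertex hd] at h1
  · intro h
    have key : ∀ r : List Dir, r.reverse ∈ D → hA.vertex (hA.treeOf c) r = hA.vertex t r →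
        hA.treeOf c r.reverse = t r.reverse := by
      intro r hr hr'
      have h1 := hA.choiceAt_vertex_treeOf c r
      have h2 := h _ hr
      rw [List.reverse_reverse, hA.choiceAt_choiceOf_vertex hd] at h2
      rw [hr', h2] at h1
      exact (letterChoice_injective _ h1).symm
    intro x hx
    have hx' : x.reverse.reverse ∈ D := by rwa [List.reverse_reverse]
    simpa using key x.reverse hx' (hv key _ hx')

theorem stateProb_toMeasure_letterChoice (q : Q) (a : Λ) :
    @PMF.toMeasure _ ⊤ (A.stateProb (.inl q) rfl) {letterChoice q a} =
      (Fintype.card Λ : ENNReal)⁻¹ := by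
  classical
  let _ : MeasurableSpace {s // A.Edge (.inl q) s} := ⊤
  rw [PMF.toMeasure_apply_singleton _ _ MeasurableSpace.measurableSet_top]
  change (PMF.map (letterChoice q) (PMF.uniformOfFintype Λ)) _ = _
  rw [PMF.map_apply, tsum_eq_single a]
  · simp
  · intro a' ha'
    rw [if_neg fun h => ha' (letterChoice_injective q h).symm]

theorem choiceMeasure_treeOf_eqOn (hd : A.TargetsDistinct) {D : Finset (List Dir)}
    (hD : ∀ x d, x ++ [d] ∈ D → x ∈ D) (t : LabelledTree Λ) :
    (A.toMBP hA).choiceMeasure {c | ∀ x ∈ D, hA.treeOf c x = t x} =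
      ∏ _x ∈ D, (Fintype.card Λ : ENNReal)⁻¹ := by
  classical
  have hinj : Function.Injective fun x : List Dir => hA.probVertex (hA.vertex t x.reverse) := by
    intro x y hxy
    have h := hA.probVertex_injective hxy
    have hx := hA.directions_vertex hd t x.reverse
    rw [h, hA.directions_vertex hd] at hx
    exact (List.reverse_injective hx).symm
  have hset : {c | ∀ x ∈ D, hA.treeOf c x = t x} =
      Set.pi (D.image fun x => hA.probVertex (hA.vertex t x.reverse) : Finset _)
        fun v => {hA.choiceOf t v} := by
    ext c
    refine (hA.treeOf_eqOn_iff hd (D := D) hD c t).trans ?_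
    change _ ↔ ∀ v ∈ D.image fun x => hA.probVertex (hA.vertex t x.reverse), c v = hA.choiceOf t v
    rw [Finset.forall_mem_image]
    rfl
  rw [hset]
  let _ : ∀ x : (A.toMBP hA).ProbVertex, MeasurableSpace {s // (A.toMBP hA).E x.1.2 s} :=
    fun _ => ⊤
  refine (Measure.infinitePi_pi (fun x : (A.toMBP hA).ProbVertex =>
    ((A.toMBP hA).p x.1.2 x.2).toMeasure)
    fun _ _ => MeasurableSpace.measurableSet_top).trans ?_
  rw [Finset.prod_image hinj.injOn]
  exact Finset.prod_congr rfl fun x _ => stateProb_toMeasure_letterChoice _ _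

/-- The letters chosen in a random branching play are independent and uniform. -/
theorem map_treeOf [Finite Q] (hd : A.TargetsDistinct) :
    (A.toMBP hA).choiceMeasure.map hA.treeOf = coinFlipping Λ := by
  classical
  let _ : MeasurableSpace Λ := ⊤
  have : MeasurableSingletonClass Λ := ⟨fun _ => MeasurableSpace.measurableSet_top⟩
  refine eq_infinitePi_of_cylinder (ι := List Dir) (α := Λ) _ fun s => ?_
  refine ⟨s.biUnion fun x => x.inits.toFinset, fun x hx => Finset.mem_biUnion.2
    ⟨x, hx, by simp⟩, fun t => ?_⟩
  have hm : MeasurableSet (Set.pi (s.biUnion fun x => x.inits.toFinset : Finset _)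
      fun i => {t i} : Set (List Dir → Λ)) :=
    MeasurableSet.pi (Finset.countable_toSet _) fun i _ => measurableSet_singleton _
  refine (Measure.map_apply (hA.measurable_treeOf hd) hm).trans ?_
  refine (hA.choiceMeasure_treeOf_eqOn hd ?_ t).trans (Finset.prod_congr rfl fun x _ => ?_)
  · intro x d hx
    simp only [Finset.mem_biUnion, List.mem_toFinset, List.mem_inits] at hx ⊢
    obtain ⟨y, hy, hxy⟩ := hx
    exact ⟨y, hy, (List.prefix_append _ _).trans hxy⟩
  · rw [PMF.toMeasure_apply_singleton _ _ MeasurableSpace.measurableSet_top,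
      PMF.uniformOfFintype_apply]

theorem measurePreserving_playEquiv [Finite Q] (hd : A.TargetsDistinct) :
    MeasurePreserving (hA.playEquiv hd) (coinFlipping Λ)
      ((A.toMBP hA).playMeasure (.inl A.q₀)) := by
  refine ⟨(hA.playEquiv hd).measurable, ?_⟩
  rw [← hA.map_treeOf hd, Measure.map_map (hA.playEquiv hd).measurable (hA.measurable_treeOf hd)]
  congr 1
  exact funext (hA.playOf_treeOf hd)

/-! ### The game on a branching play -/

/-- The position at time `n` of the game on the branching play of `t` if the directions `r` have
been chosen before: one round consists of a vertex labelled by some `s_q` and its child, labelled by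
`s_{q,a}`. -/
def playPos (hd : A.TargetsDistinct) (t : LabelledTree Λ) (n : ℕ) (r : List Dir) :
    {x // x ∈ (hA.playOf t).1} :=
  if n % 2 = 0 then ⟨hA.stateNode t r, (hA.mem_playOf hd t _).2 ⟨r, Or.inl rfl⟩⟩
  else ⟨hA.letterNode t r, (hA.mem_playOf hd t _).2 ⟨r, Or.inr rfl⟩⟩

theorem playPos_even (hd : A.TargetsDistinct) (t : LabelledTree Λ) (m : ℕ) (r : List Dir) :
    (hA.playPos hd t (2 * m) r).1 = hA.stateNode t r := by
  rw [playPos, if_pos (by omega)]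

theorem playPos_odd (hd : A.TargetsDistinct) (t : LabelledTree Λ) (m : ℕ) (r : List Dir) :
    (hA.playPos hd t (2 * m + 1) r).1 = hA.letterNode t r := by
  rw [playPos, if_neg (by omega)]

theorem move_stateNode_iff (hd : A.TargetsDistinct) (t : LabelledTree Λ) (r : List Dir)
    (y : {x // x ∈ (hA.playOf t).1}) :
    (∃ s, y.1 = (hA.stateNode t r).extend s) ↔ y.1 = hA.letterNode t r := by
  constructor
  · rintro ⟨s, hs⟩
    obtain ⟨r', h | h⟩ := (hA.mem_playOf hd t _).1 y.2
    · rw [hs] at h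
      cases r' with
      | nil => simp [FinPath.extend, stateNode, vertex] at h
      | cons d r' =>
        rw [stateNode_cons] at h
        have h := congrArg Prod.snd (FinPath.extend_inj.1 h).1
        simp [letterNode, stateNode, FinPath.extend] at h
    · rw [hs] at h
      rw [hA.stateNode_injective hd t (FinPath.extend_inj.1 h).1, hs, h]
  · exact fun h => ⟨_, h⟩

theorem move_letterNode_iff (hd : A.TargetsDistinct) (t : LabelledTree Λ) (r : List Dir)
    (y : {x // x ∈ (hA.playOf t).1}) :
    (∃ s, y.1 = (hA.letterNode t r).extend s) ↔ ∃ d, y.1 = hA.stateNode t (d :: r) := by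
  constructor
  · rintro ⟨s, hs⟩
    obtain ⟨r', h | h⟩ := (hA.mem_playOf hd t _).1 y.2
    · rw [hs] at h
      cases r' with
      | nil => simp [FinPath.extend, stateNode, vertex] at h
      | cons d r' =>
        have h' := h
        rw [stateNode_cons] at h'
        rw [hA.letterNode_injective hd t (FinPath.extend_inj.1 h').1, hs]
        exact ⟨d, h⟩
    · rw [hs] at h
      have h := congrArg Prod.snd (FinPath.extend_inj.1 h).1
      simp [letterNode, stateNode, FinPath.extend] at h
  · rintro ⟨d, h⟩
    exact ⟨_, h⟩

/-- The plays on the branching play of `t` correspond to the branches of the full binary tree. -/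
def playUnfolding (hd : A.TargetsDistinct) (t : LabelledTree Λ) :
    ((A.toMBP hA).playGame (hA.playOf t)).Unfolding where
  pos := hA.playPos hd t
  count n := n / 2
  time m := 2 * m + 1
  count_zero := rfl
  count_succ n := by omega
  count_time m := by omega
  count_time_succ m := by omega
  time_count n h := by omega
  pos_zero := rfl
  pos_injective n r r' _ _ h := by
    have h := congrArg Subtype.val h
    obtain ⟨m, rfl | rfl⟩ := n.even_or_odd'
    · rw [playPos_even, playPos_even] at h
      exact hA.stateNode_injective hd t h
    · rw [playPos_odd, playPos_odd] at h
      exact hA.letterNode_injective hd t h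
  move_forced n r hr hn v := by
    obtain ⟨m, rfl⟩ : ∃ m, n = 2 * m := ⟨n / 2, by omega⟩
    rw [Subtype.ext_iff, playPos_odd, ← hA.move_stateNode_iff hd, ← hA.playPos_even hd t m]
    rfl
  move_choice n r hr hn v := by
    obtain ⟨m, rfl⟩ : ∃ m, n = 2 * m + 1 := ⟨n / 2, by omega⟩
    simp only [Subtype.ext_iff, show 2 * m + 1 + 1 = 2 * (m + 1) by ring, playPos_even]
    rw [← hA.move_letterNode_iff hd, ← hA.playPos_odd hd t m]
    rfl
  exists_move v hv := by
    obtain ⟨s, hs⟩ := (A.toMBP hA).exists_succ v.1.2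
    have hv' : (A.toMBP hA).kind v.1.2 ≠ .prob := by
      rw [show (A.toMBP hA).kind v.1.2 = .existsBranch from hv]
      exact fun h => by cases h
    exact ⟨⟨_, (hA.playOf t).2.branch _ v.2 hv' s hs⟩, s, rfl⟩

theorem playOf_mem_winning_iff (hd : A.TargetsDistinct) (t : LabelledTree Λ) :
    hA.playOf t ∈ (A.toMBP hA).winning (.inl A.q₀) ↔ hA.WinsOn t := by
  change ((A.toMBP hA).playGame (hA.playOf t)).ExistsWins ↔ _
  rw [(hA.playUnfolding hd t).existsWins_iff, WinsOn]
  have h1 : (fun r : List Dir => ((A.toMBP hA).playGame (hA.playOf t)).existsTurn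
      ((hA.playUnfolding hd t).pos ((hA.playUnfolding hd t).time r.length) r)) =
      hA.ExistsTurn t := by
    ext r
    change A.stateKind (hA.playPos hd t (2 * r.length + 1) r).1.2 = .existsBranch ↔ _
    rw [playPos_odd]
    change A.stateKind (.inr (hA.state t r, t r.reverse)) = .existsBranch ↔ _
    rw [ExistsTurn]
    cases h : A.δ (hA.state t r) (t r.reverse) <;> simp [stateKind, h]
  have h2 : (fun b => ((A.toMBP hA).playGame (hA.playOf t)).win
      ((hA.playUnfolding hd t).play b)) = fun b =>
      MaxEven {k | ∃ᶠ n in Filter.atTop, A.π (hA.state t (initialSegment b n)) = k} := by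
    ext b
    -- the two states of a round have the same priority
    have hpar : ∀ n, (A.toMBP hA).par ((hA.playUnfolding hd t).play b n).1.2 =
        A.π (hA.state t (initialSegment b (n / 2))) := by
      intro n
      change A.statePar (hA.playPos hd t n (initialSegment b (n / 2))).1.2 = _
      obtain ⟨m, hm | hm⟩ := n.even_or_odd'
      · rw [hm, playPos_even]
        rfl
      · rw [hm, playPos_odd]
        rfl
    change MaxEven {k | ∃ᶠ n in Filter.atTop,
      (A.toMBP hA).par ((hA.playUnfolding hd t).play b n).1.2 = k} ↔ _
    simp only [hpar]
    have h : ∀ k, (∃ᶠ n in Filter.atTop, A.π (hA.state t (initialSegment b (n / 2))) = k) ↔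
        ∃ᶠ n in Filter.atTop, A.π (hA.state t (initialSegment b n)) = k := by
      intro k
      simp only [Filter.frequently_atTop]
      constructor
      · intro h N
        obtain ⟨n, hn, hk⟩ := h (2 * N)
        exact ⟨n / 2, by omega, hk⟩
      · intro h N
        obtain ⟨n, hn, hk⟩ := h N
        exact ⟨2 * n, by omega, by rwa [Nat.mul_div_cancel_left n two_pos]⟩
    simp only [h]
  rw [h1, h2]

theorem mem_language_iff_playEquiv_mem_winning [Finite Q] (hd : A.TargetsDistinct)
    (t : LabelledTree Λ) :
    t ∈ A.language ↔ hA.playEquiv hd t ∈ (A.toMBP hA).winning (.inl A.q₀) := by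
  rw [playEquiv_apply, hA.playOf_mem_winning_iff hd, hA.mem_language_iff]

theorem coinFlipping_language [Finite Q] (hd : A.TargetsDistinct) :
    coinFlipping Λ A.language = (A.toMBP hA).val (.inl A.q₀) := by
  have h : A.language = hA.playEquiv hd ⁻¹' (A.toMBP hA).winning (.inl A.q₀) :=
    Set.ext (hA.mem_language_iff_playEquiv_mem_winning hd)
  rw [h, (hA.measurePreserving_playEquiv hd).measure_preimage_equiv, MBP.val]

end Automaton.IsGame

end GameAut

end

open GameAut
theorem mainTheorem3 {Λ Q : Type*} [Fintype Λ] [Nonempty Λ] [Finite Q]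
    (A : Automaton Λ Q) (hA : A.IsGame) :
    (A.TargetsDistinct →
      coinFlipping Λ A.language = (A.toMBP hA).val (Sum.inl A.q₀) ∧
      ∃ Φ : LabelledTree Λ ≃ᵐ (A.toMBP hA).BranchingPlay (Sum.inl A.q₀),
        MeasureTheory.MeasurePreserving Φ (coinFlipping Λ)
          ((A.toMBP hA).playMeasure (Sum.inl A.q₀)) ∧
        ∀ t, t ∈ A.language ↔ Φ t ∈ (A.toMBP hA).winning (Sum.inl A.q₀)) ∧
    (A.duplicate.TargetsDistinct ∧ A.duplicate.language = A.language ∧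
      coinFlipping Λ A.language =
        (A.duplicate.toMBP hA.duplicate).val (Sum.inl A.duplicate.q₀)) := by
  refine ⟨fun hd => ⟨hA.coinFlipping_language hd, hA.playEquiv hd,
    hA.measurePreserving_playEquiv hd, hA.mem_language_iff_playEquiv_mem_winning hd⟩,
    hA.targetsDistinct_duplicate, hA.language_duplicate, ?_⟩
  rw [← hA.language_duplicate]
  exact hA.duplicate.coinFlipping_language hA.targetsDistinct_duplicate
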